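/- **Problem.** An instance of *eventual influence limitation* (EIL) consists of a loopless directed graph $G=(V,E)$ with $|V|=n$, $|E|=m$, an adversary node $v_c\in V$, and probabilities $p_C(e)\in[0,1]$ for $e\in E$. Each edge is independently *realized* with probability $p_C(e)$; let $g$ be the random set of realized edges. For a seed set $S\subseteq V\setminus\{v_c\}$, campaign $C$ starts active at $v_c$ and campaign $L$ at the nodes of $S$, all other nodes being inactive. In each time step, every inactive node with an in-neighbour (in $G$) active in $L$ becomes active in $L$, and every other inactive node with an in-neighbour along an edge of $g$ active in $C$ becomes active in $C$; active nodes never change. The prevention $\pi(S)$ is the number of nodes that eventually adopt $C$ if $L$ is absent, but do not adopt $C$ if $L$ starts from $S$. For $k\ge 1$, a set $S\subseteq V\setminus\{v_c\}$ with $|S|\le k$ is *$\beta$-approximate* if $\mathbb E[\pi(S)]\ge\beta\,\mathbb E[\pi(S')]$ for all $S'\subseteq V\setminus\{v_c\}$ with $|S'|=k$. **Model.** A randomized algorithm is given $v_c$ (and may depend on $n,m,k,\beta$ and on the required success probability). One unit of time pays for one of the following operations: drawing a uniformly random node; asking for the out-degree or in-degree of a node; reading one entry (a neighbour, with the probability $p_C$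 of the edge) of the out- or in-adjacency list of a node; writing one node into the output. Internal computation and internal discrete random choices are free. The running time is the number of these operations before halting. **Theorem.** Let $k\ge1$ be an integer and $0<\beta\le 1$. 1. For all $0<\epsilon<\frac1{10e}$, all $n>k$, and $m=n-1$: every randomized algorithm that on each EIL instance with $n$ nodes and $m$ edges returns a $\beta$-approximate seed set with probability at least $1-\frac1e-\epsilon$ has, on at least one such instance, expected running time at least $$\frac{\beta\,(m+n)}{24\,\min\{k,1/\beta\}} .$$ 2. There are $c>0$ and $n_0$, depending only on $k$ and $\beta$, such that the same holds for all $0<\epsilon<\frac1{10e}$, all $n\ge n_0$ and every $m$ with $n-1\le m\le c\,n^2$. -/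

import Mathlib

open scoped ENNReal

noncomputable section

namespace EIL

/-- An instance of eventual influence limitation on `n` nodes, with the high effectiveness property:
a directed graph without loops, the adversary node `vc` (`A_C = {vc}`), and for each edge `e` the
probability `pC e` that campaign `C` propagates along `e`. Campaign `L` propagates along every edge
with probability one. The orders in which the out- and in-adjacency lists enumerate the neighbours
are arbitrary and belong to the representation of the instance. -/
structure Network (n : ℕ) where
  vc : Fin n
  edges : Finset (Fin n × Fin n)
  loopless : ∀ v, (v, v) ∉ edges
  pC : Fin n × Fin n → ℝ
  pC_mem : ∀ e, pC e ∈ Set.Icc (0 : ℝ) 1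
  outList : Fin n → List (Fin n)
  outList_nodup : ∀ u, (outList u).Nodup
  mem_outList : ∀ u v, v ∈ outList u ↔ (u, v) ∈ edges
  inList : Fin n → List (Fin n)
  inList_nodup : ∀ v, (inList v).Nodup
  mem_inList : ∀ u v, u ∈ inList v ↔ (u, v) ∈ edges

/-- The pair (nodes active in campaign `C`, nodes active in campaign `L`). -/
abbrev Status (n : ℕ) := Finset (Fin n) × Finset (Fin n)

/-- The nodes that campaign `L` activates next: inactive nodes with an in-neighbour active in `L`. -/
def newL {n : ℕ} (E : Finset (Fin n × Fin n)) (a : Status n) : Finset (Fin n) :=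
  {v | v ∉ a.1 ∧ v ∉ a.2 ∧ ∃ u ∈ a.2, (u, v) ∈ E}

/-- The nodes that campaign `C` activates next along the realized edges `g`: inactive nodes with an
in-neighbour active in `C`, unless campaign `L` activates them at the same time. -/
def newC {n : ℕ} (E g : Finset (Fin n × Fin n)) (a : Status n) : Finset (Fin n) :=
  {v | v ∉ a.1 ∧ v ∉ a.2 ∧ v ∉ newL E a ∧ ∃ u ∈ a.1, (u, v) ∈ g}

/-- One time step of the two-campaign cascade when `g` is the set of edges realized for `C`.
(The attempt of a node along an edge succeeds or fails once and for all, namely when the node has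
just been activated, so letting all active nodes act in every step changes nothing.) -/
def cascadeStep {n : ℕ} (E g : Finset (Fin n × Fin n)) (a : Status n) : Status n :=
  (a.1 ∪ newC E g a, a.2 ∪ newL E a)

namespace Network

variable {n : ℕ}

/-- The number `m` of edges. -/
def numEdges (I : Network n) : ℕ := I.edges.card

/-- The nodes that have adopted campaign `C` when the cascade from `A_C = {vc}` and `A_L = S` has
converged (each step before convergence activates a node, so `n` steps suffice). -/
def adoptC (I : Network n) (g : Finset (Fin n × Fin n)) (S : Finset (Fin n)) : Finset (Fin n) :=
  ((cascadeStep I.edges g)^[n] ({I.vc}, S)).1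

/-- The prevention `π(S)` on the realization `g`: the number of nodes that adopt `C` in the absence
of campaign `L`, but not when `L` starts from `S`. -/
def prevention (I : Network n) (g : Finset (Fin n × Fin n)) (S : Finset (Fin n)) : ℕ :=
  (I.adoptC g ∅ \ I.adoptC g S).card

/-- The probability that `g` is the set of realized edges, each edge being realized independently. -/
def realizationProb (I : Network n) (g : Finset (Fin n × Fin n)) : ℝ :=
  (∏ e ∈ g, I.pC e) * ∏ e ∈ I.edges \ g, (1 - I.pC e)

/-- The expected prevention `𝔼[π(S)]`. -/
def expectedPrevention (I : Network n) (S : Finset (Fin n)) : ℝ :=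
  ∑ g ∈ I.edges.powerset, I.realizationProb g * (I.prevention g S : ℝ)

/-- `S` is a seed set for `L` of at most `k` nodes, none of them the adversary node, and its
expected prevention is at least `β` times that of every seed set of size `k`. -/
def IsApprox (I : Network n) (k : ℕ) (β : ℝ) (S : Finset (Fin n)) : Prop :=
  I.vc ∉ S ∧ S.card ≤ k ∧
    ∀ S' : Finset (Fin n), I.vc ∉ S' → S'.card = k →
      β * I.expectedPrevention S' ≤ I.expectedPrevention S

end Network

/-- The basic operations, each of which costs one unit of time: drawing a uniformly random node,
asking for the out- or in-degree of a node or for an entry of its out- or in-adjacency list, and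
writing a node into the output. `halt` ends the computation. -/
inductive Op (n : ℕ) where
  | halt
  | sample
  | outDegree (v : Fin n)
  | inDegree (v : Fin n)
  | outEntry (v : Fin n) (i : ℕ)
  | inEntry (v : Fin n) (i : ℕ)
  | write (v : Fin n)

/-- The answers to the basic operations. An entry of an adjacency list consists of the neighbour
and of the propagation probability of the edge; it is `none` beyond the end of the list. -/
inductive Answer (n : ℕ) where
  | node (v : Fin n)
  | degree (d : ℕ)
  | entry (x : Option (Fin n × ℝ))
  | written

/-- A randomized algorithm on networks with `n` nodes. It is given the adversary node; everything
else about the network has to be found out by basic operations. Arbitrary internal computation and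
internal random choices between two basic operations are free of charge, and nodes may be addressed
by name, so that lower bounds on the number of basic operations are lower bounds on running time. -/
structure Algorithm (n : ℕ) where
  State : Type
  init : Fin n → PMF State
  op : State → Op n
  next : State → Answer n → PMF State

namespace Algorithm

variable {n : ℕ}

/-- An internal state together with the set of nodes written so far. -/
abbrev Config (A : Algorithm n) := A.State × Finset (Fin n)

/-- One step of the algorithm on the network `I`. -/
def step (A : Algorithm n) (I : Network n) (c : A.Config) : PMF A.Config :=
  haveI : Nonempty (Fin n) := ⟨I.vc⟩
  let continueWith : Answer n → Finset (Fin n) → PMF A.Config :=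
    fun a S => (A.next c.1 a).map fun s => (s, S)
  match A.op c.1 with
  | .halt => PMF.pure c
  | .sample => (PMF.uniformOfFintype (Fin n)).bind fun v => continueWith (.node v) c.2
  | .outDegree v => continueWith (.degree (I.outList v).length) c.2
  | .inDegree v => continueWith (.degree (I.inList v).length) c.2
  | .outEntry v i => continueWith (.entry ((I.outList v)[i]?.map fun w => (w, I.pC (v, w)))) c.2
  | .inEntry v i => continueWith (.entry ((I.inList v)[i]?.map fun u => (u, I.pC (u, v)))) c.2
  | .write v => continueWith .written (insert v c.2)

/-- The distribution of the configuration after `t` steps. -/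
def run (A : Algorithm n) (I : Network n) : ℕ → PMF A.Config
  | 0 => (A.init I.vc).map fun s => (s, ∅)
  | t + 1 => (A.run I t).bind (A.step I)

/-- The expected running time `∑ₜ ℙ(not halted after t steps)`. -/
def expectedTime (A : Algorithm n) (I : Network n) : ℝ≥0∞ :=
  ∑' t : ℕ, (A.run I t).toOuterMeasure {c | A.op c.1 ≠ .halt}

/-- The probability that the algorithm halts and has written a `β`-approximate seed set. -/
def successProb (A : Algorithm n) (I : Network n) (k : ℕ) (β : ℝ) : ℝ≥0∞ :=
  ⨆ t : ℕ, (A.run I t).toOuterMeasure {c | A.op c.1 = .halt ∧ I.IsApprox k β c.2}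

/-- On every network with `m` edges the algorithm returns a `β`-approximate seed set with
probability at least `p`. -/
def Solves (A : Algorithm n) (m k : ℕ) (β p : ℝ) : Prop :=
  ∀ I : Network n, I.numEdges = m → ENNReal.ofReal p ≤ A.successProb I k β

end Algorithm

end EIL

end

/-!
Hide one certain edge among many edges along which campaign `C` never propagates. Until the hidden
edge is read, a run is distributed as on the network without it, and every operation reads at most
one edge. Hence an algorithm that succeeds wherever the edge is hidden either spends time
proportional to the number of candidates on the network without hidden edge, or writes outputs there
that are approximate for many candidates at once.

In a star with center `vc`, an approximate seed set contains the head of the hidden edge, so serving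
many candidates means writing many nodes, which also costs time. For more edges, take as candidates
the edges of `q` disjoint complete bipartite graphs whose left sides are reached surely and whose
right vertices have `R ≥ k / β` leaves each. Protecting the hidden head and its leaves prevents
`R + 1` adoptions, whereas `k` seeds outside the block of the hidden edge prevent at most
`k < β (R + 1)`. So an approximate set meets that block, and it can meet at most `k` of the
`q ≥ 4 k / p` blocks, where `p` is the success probability. Filler nodes and edges adjust the sizes.
-/

namespace EIL

section Expect

variable {α γ : Type*}

/-- The expectation of an extended nonnegative function with respect to a probability mass
function, as a sum rather than a Lebesgue integral, so that `α` needs no measurable structure. -/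
noncomputable def expect (μ : PMF α) (f : α → ℝ≥0∞) : ℝ≥0∞ := ∑' a, μ a * f a

lemma expect_pure (a : α) (f : α → ℝ≥0∞) : expect (PMF.pure a) f = f a := by
  rw [expect, tsum_eq_single a fun b hb => by simp [PMF.pure_apply, hb]]
  simp

lemma expect_bind (μ : PMF α) (κ : α → PMF γ) (f : γ → ℝ≥0∞) :
    expect (μ.bind κ) f = expect μ fun a => expect (κ a) f := by
  simp_rw [expect, PMF.bind_apply, ← ENNReal.tsum_mul_right, ← ENNReal.tsum_mul_left]
  rw [ENNReal.tsum_comm]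
  simp_rw [mul_assoc]

lemma expect_map (μ : PMF α) (g : α → γ) (f : γ → ℝ≥0∞) :
    expect (μ.map g) f = expect μ fun a => f (g a) := by
  simp only [PMF.map, expect_bind, Function.comp_apply, expect_pure]

lemma expect_const (μ : PMF α) (c : ℝ≥0∞) : expect μ (fun _ => c) = c := by
  simp [expect, ENNReal.tsum_mul_right]

lemma expect_mono (μ : PMF α) {f g : α → ℝ≥0∞} (h : ∀ a, f a ≤ g a) : expect μ f ≤ expect μ g :=
  ENNReal.tsum_le_tsum fun a => mul_le_mul_right (h a) _

lemma expect_add (μ : PMF α) (f g : α → ℝ≥0∞) :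
    expect μ (fun a => f a + g a) = expect μ f + expect μ g := by
  simp only [expect, mul_add, ENNReal.tsum_add]

lemma expect_sum {ι : Type*} (s : Finset ι) (μ : PMF α) (f : ι → α → ℝ≥0∞) :
    expect μ (fun a => ∑ i ∈ s, f i a) = ∑ i ∈ s, expect μ (f i) := by
  simp only [expect, Finset.mul_sum]
  exact Summable.tsum_finsetSum fun i _ => ENNReal.summable

lemma expect_le_of_le (μ : PMF α) {f : α → ℝ≥0∞} {c : ℝ≥0∞} (h : ∀ a, f a ≤ c) :
    expect μ f ≤ c :=
  (expect_mono μ h).trans_eq (expect_const μ c)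

lemma toOuterMeasure_eq_expect_indicator (μ : PMF α) (s : Set α) :
    μ.toOuterMeasure s = expect μ (s.indicator 1) := by
  rw [PMF.toOuterMeasure_apply, expect]
  exact tsum_congr fun a => by by_cases h : a ∈ s <;> simp [h]

lemma sum_toOuterMeasure_eq_expect_ncard {ι : Type*} [Fintype ι] (μ : PMF α) (s : ι → Set α) :
    ∑ i, μ.toOuterMeasure (s i) = expect μ fun a => ({i | a ∈ s i}.ncard : ℝ≥0∞) := by
  classical
  simp only [toOuterMeasure_eq_expect_indicator, ← expect_sum]
  congr! 2 with a
  simp [Set.indicator_apply, Set.ncard_eq_toFinset_card']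

end Expect

/-! ### Runs of an algorithm on networks that differ in one edge -/

/-- The edge whose propagation probability is disclosed by the answer to an operation. -/
def Network.probe {n : ℕ} (I : Network n) : Op n → Option (Fin n × Fin n)
  | .outEntry v i => (I.outList v)[i]?.map fun w => (v, w)
  | .inEntry v i => (I.inList v)[i]?.map fun u => (u, v)
  | _ => none

/-- Two networks agree off the edge `e` if an algorithm can distinguish them only by reading the
propagation probability of `e`. The edge sets need not be compared, since they are determined by
the adjacency lists. -/
structure Network.AgreeOff {n : ℕ} (I J : Network n) (e : Fin n × Fin n) : Prop where
  vc : J.vc = I.vc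
  outList : J.outList = I.outList
  inList : J.inList = I.inList
  pC : ∀ x, x ≠ e → J.pC x = I.pC x

namespace Algorithm

variable {n : ℕ} (A : Algorithm n)

lemma step_congr {I J : Network n} {e : Fin n × Fin n} (h : I.AgreeOff J e) (c : A.Config)
    (hc : I.probe (A.op c.1) ≠ some e) : A.step J c = A.step I c := by
  unfold step
  cases hop : A.op c.1 with
  | halt | sample | write => rfl
  | outDegree v => simp only [h.outList]
  | inDegree v => simp only [h.inList]
  | outEntry v i =>
    simp only [h.outList]
    cases hl : (I.outList v)[i]? with
    | none => rfl
    | some w =>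
      have hne : (v, w) ≠ e := by simpa [hop, Network.probe, hl] using hc
      simp only [Option.map_some, h.pC _ hne]
  | inEntry v i =>
    simp only [h.inList]
    cases hl : (I.inList v)[i]? with
    | none => rfl
    | some u =>
      have hne : (u, v) ≠ e := by simpa [hop, Network.probe, hl] using hc
      simp only [Option.map_some, h.pC _ hne]

/-- The probability that the operation performed after `t` steps reads the edge `e`. -/
noncomputable def probeProb (I : Network n) (e : Fin n × Fin n) (t : ℕ) : ℝ≥0∞ :=
  (A.run I t).toOuterMeasure {c | I.probe (A.op c.1) = some e}

/-- The probability that the algorithm has not halted after `t` steps. -/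
noncomputable def activeProb (I : Network n) (t : ℕ) : ℝ≥0∞ :=
  (A.run I t).toOuterMeasure {c | A.op c.1 ≠ .halt}

lemma sum_activeProb_le_expectedTime (I : Network n) (t : ℕ) :
    ∑ s ∈ Finset.range t, A.activeProb I s ≤ A.expectedTime I :=
  ENNReal.sum_le_tsum _

lemma sum_probeProb_le_activeProb {ι : Type*} [Fintype ι] (I : Network n) {e : ι → Fin n × Fin n}
    (he : Function.Injective e) (t : ℕ) :
    ∑ i, A.probeProb I (e i) t ≤ A.activeProb I t := by
  simp only [probeProb, sum_toOuterMeasure_eq_expect_ncard]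
  rw [activeProb, toOuterMeasure_eq_expect_indicator]
  refine expect_mono _ fun c => ?_
  by_cases hc : A.op c.1 = .halt
  · simp [hc, Network.probe]
  · have hone : {i | I.probe (A.op c.1) = some (e i)}.ncard ≤ 1 :=
      (Set.ncard_le_one_iff (Set.toFinite _)).2 fun hi hj =>
        he (Option.some_injective _ (hi.symm.trans hj))
    simpa [hc] using hone

lemma expect_run_le_add_sum_probeProb {I J : Network n} {e : Fin n × Fin n} (h : I.AgreeOff J e)
    (t : ℕ) (f : A.Config → ℝ≥0∞) (hf : ∀ c, f c ≤ 1) :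
    expect (A.run J t) f ≤ expect (A.run I t) f + ∑ s ∈ Finset.range t, A.probeProb I e s := by
  induction t generalizing f with
  | zero => simp [run, h.vc]
  | succ t ih =>
    have hstep (c : A.Config) : expect (A.step J c) f ≤
        expect (A.step I c) f + {c | I.probe (A.op c.1) = some e}.indicator 1 c := by
      by_cases hc : I.probe (A.op c.1) = some e
      · simpa [hc] using (expect_le_of_le _ hf).trans le_add_self
      · simp [hc, A.step_congr h c hc]
    simp only [run, expect_bind]
    calc expect (A.run J t) (fun c => expect (A.step J c) f)
        ≤ expect (A.run I t) (fun c => expect (A.step J c) f) +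
            ∑ s ∈ Finset.range t, A.probeProb I e s := ih _ fun c => expect_le_of_le _ hf
      _ ≤ expect (A.run I t) (fun c => expect (A.step I c) f) + A.probeProb I e t +
            ∑ s ∈ Finset.range t, A.probeProb I e s := by
          gcongr
          rw [probeProb, toOuterMeasure_eq_expect_indicator, ← expect_add]
          exact expect_mono _ hstep
      _ = _ := by rw [Finset.sum_range_succ, add_assoc, add_comm (A.probeProb I e t)]

lemma monotone_prob_halt_and (I : Network n) (P : Finset (Fin n) → Prop) :
    Monotone fun t => (A.run I t).toOuterMeasure {c | A.op c.1 = .halt ∧ P c.2} := by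
  refine monotone_nat_of_le_succ fun t => ?_
  simp only [toOuterMeasure_eq_expect_indicator, run, expect_bind]
  refine expect_mono _ fun c => ?_
  by_cases hc : A.op c.1 = .halt ∧ P c.2
  · have hstep : A.step I c = PMF.pure c := by
      unfold step
      rw [hc.1]
    rw [hstep, expect_pure]
  · simp [hc]

lemma sum_successProb_le {ι : Type*} [Fintype ι] {I : Network n} {J : ι → Network n}
    {e : ι → Fin n × Fin n} (he : Function.Injective e) (h : ∀ i, I.AgreeOff (J i) (e i))
    {k : ℕ} {β : ℝ} {B : ℝ≥0∞}
    (hB : ∀ t, expect (A.run I t) (fun c => ({i | (J i).IsApprox k β c.2}.ncard : ℝ≥0∞)) ≤ B) :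
    ∑ i, A.successProb (J i) k β ≤ A.expectedTime I + B := by
  simp only [successProb]
  rw [ENNReal.finsetSum_iSup_of_monotone fun i => A.monotone_prob_halt_and (J i) _]
  refine iSup_le fun t => ?_
  have hrun (i : ι) : (A.run (J i) t).toOuterMeasure
        {c | A.op c.1 = .halt ∧ (J i).IsApprox k β c.2} ≤
      (A.run I t).toOuterMeasure {c | (J i).IsApprox k β c.2} +
        ∑ s ∈ Finset.range t, A.probeProb I (e i) s := by
    refine (MeasureTheory.OuterMeasure.mono _ fun c hc => hc.2).trans ?_
    simp only [toOuterMeasure_eq_expect_indicator]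
    exact A.expect_run_le_add_sum_probeProb (h i) t _ (Set.indicator_le_self' (by simp))
  calc _ ≤ ∑ i, (A.run I t).toOuterMeasure {c | (J i).IsApprox k β c.2} +
        ∑ s ∈ Finset.range t, ∑ i, A.probeProb I (e i) s := by
        rw [Finset.sum_comm, ← Finset.sum_add_distrib]
        exact Finset.sum_le_sum fun i _ => hrun i
    _ ≤ B + ∑ s ∈ Finset.range t, A.activeProb I s := by
        rw [sum_toOuterMeasure_eq_expect_ncard]
        gcongr with s
        · exact hB t
        · exact A.sum_probeProb_le_activeProb I he s
    _ ≤ A.expectedTime I + B := by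
        rw [add_comm]
        gcongr
        exact A.sum_activeProb_le_expectedTime I t

lemma expect_card_output_le_expectedTime (I : Network n) (t : ℕ) :
    expect (A.run I t) (fun c => (c.2.card : ℝ≥0∞)) ≤ A.expectedTime I := by
  refine le_trans ?_ (A.sum_activeProb_le_expectedTime I t)
  induction t with
  | zero => simp [run, expect_map, expect_const]
  | succ t ih =>
    rw [Finset.sum_range_succ]
    refine le_trans ?_ (add_le_add_left ih _)
    rw [activeProb, toOuterMeasure_eq_expect_indicator, ← expect_add, run, expect_bind]
    refine expect_mono _ fun c => ?_
    unfold step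
    cases hop : A.op c.1 with
    | halt => simp [expect_pure]
    | sample => simp [expect_bind, expect_map, expect_const, hop]
    | outDegree | inDegree | outEntry | inEntry => simp [expect_map, expect_const, hop]
    | write v =>
      have hcard : ((insert v c.2).card : ℝ≥0∞) ≤ (c.2.card : ℝ≥0∞) + 1 := by
        exact_mod_cast Finset.card_insert_le v c.2
      simpa [expect_map, expect_const, hop] using hcard

end Algorithm

/-! ### The eventual state of the cascade -/

section Stabilization

variable {n : ℕ} {E g : Finset (Fin n × Fin n)} {a : Status n}

lemma cascadeStep_eq_self (h : ((cascadeStep E g a).1 ∪ (cascadeStep E g a).2).card ≤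
    (a.1 ∪ a.2).card) : cascadeStep E g a = a := by
  have hactive : a.1 ∪ a.2 = (cascadeStep E g a).1 ∪ (cascadeStep E g a).2 :=
    Finset.eq_of_subset_of_card_le
      (Finset.union_subset_union Finset.subset_union_left Finset.subset_union_left) h
  have hmem (v : Fin n) : v ∈ newC E g a ∨ v ∈ newL E a → v ∈ a.1 ∨ v ∈ a.2 := by
    rw [← Finset.mem_union (s := a.1), hactive]
    simp only [cascadeStep, Finset.mem_union]
    tauto
  refine Prod.ext (Finset.union_eq_left.2 fun v hv => ?_) (Finset.union_eq_left.2 fun v hv => ?_)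
  · have := hmem v (Or.inl hv)
    simp only [newC, Finset.mem_filter, Finset.mem_univ, true_and] at hv
    tauto
  · have := hmem v (Or.inr hv)
    simp only [newL, Finset.mem_filter, Finset.mem_univ, true_and] at hv
    tauto

lemma cascadeStep_iterate_eq_self (E g : Finset (Fin n × Fin n)) (a : Status n) :
    cascadeStep E g ((cascadeStep E g)^[n] a) = (cascadeStep E g)^[n] a := by
  let active (t : ℕ) : Finset (Fin n) :=
    ((cascadeStep E g)^[t] a).1 ∪ ((cascadeStep E g)^[t] a).2
  have hmono : Monotone fun t => (active t).card := monotone_nat_of_le_succ fun t => by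
    simp only [active, Function.iterate_succ_apply']
    exact Finset.card_le_card
      (Finset.union_subset_union Finset.subset_union_left Finset.subset_union_left)
  have hbound (t : ℕ) : (active t).card ≤ n := by simpa using (active t).card_le_univ
  have hstab (t : ℕ) (ht : (active t).card = (active (t + 1)).card) :
      (active (t + 1)).card = (active (t + 2)).card := by
    have hfix : (cascadeStep E g)^[t + 1] a = (cascadeStep E g)^[t] a := by
      rw [Function.iterate_succ_apply']
      refine cascadeStep_eq_self ?_
      rw [← Function.iterate_succ_apply' (cascadeStep E g)]
      exact ht.ge
    have hfix' : (cascadeStep E g)^[t + 2] a = (cascadeStep E g)^[t + 1] a := by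
      rw [Function.iterate_succ_apply', hfix, ← Function.iterate_succ_apply' (cascadeStep E g),
        hfix]
    simp only [active, hfix']
  refine cascadeStep_eq_self (le_of_eq ?_)
  rw [← Function.iterate_succ_apply' (cascadeStep E g)]
  exact Nat.stabilises_of_monotone hmono hbound hstab n.le_succ

end Stabilization

namespace Network

variable {n : ℕ} (I : Network n) {g : Finset (Fin n × Fin n)} {S : Finset (Fin n)}

/-- The nodes that have adopted campaign `L` when the cascade has converged, the counterpart of
`Network.adoptC`. -/
def adoptL (g : Finset (Fin n × Fin n)) (S : Finset (Fin n)) : Finset (Fin n) :=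
  ((cascadeStep I.edges g)^[n] ({I.vc}, S)).2

lemma vc_mem_adoptC : I.vc ∈ I.adoptC g S :=
  Function.Iterate.rec (fun a : Status n => I.vc ∈ a.1)
    (Finset.mem_singleton_self _) (fun _ h => Finset.mem_union_left _ h) n

lemma mem_adoptC_of_edge {u v : Fin n} (hu : u ∈ I.adoptC g S) (huv : (u, v) ∈ g)
    (hv : v ∉ I.adoptL g S) : v ∈ I.adoptC g S := by
  obtain ⟨hC, hL⟩ := Prod.ext_iff.1 (cascadeStep_iterate_eq_self I.edges g ({I.vc}, S))
  have hnewL : v ∉ newL I.edges ((cascadeStep I.edges g)^[n] ({I.vc}, S)) :=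
    fun h => hv (Finset.union_eq_left.1 hL h)
  by_contra hvC
  refine hvC (Finset.union_eq_left.1 hC ?_)
  simp only [newC, Finset.mem_filter, Finset.mem_univ, true_and]
  exact ⟨hvC, hv, hnewL, u, hu, huv⟩

lemma adoptC_subset {Q : Set (Fin n)} (hvc : I.vc ∈ Q)
    (hQ : ∀ u v, (u, v) ∈ g → u ∈ Q → v ∈ Q ∨ v ∈ S) : ↑(I.adoptC g S) ⊆ Q := by
  refine (Function.Iterate.rec (fun a : Status n => S ⊆ a.2 ∧ ↑a.1 ⊆ Q)
    (a := ({I.vc}, S)) ⟨subset_rfl, by simpa using hvc⟩ (fun a h => ?_) n).2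
  refine ⟨h.1.trans Finset.subset_union_left, fun v hv => ?_⟩
  rcases Finset.mem_union.1 hv with hv | hv
  · exact h.2 hv
  · simp only [newC, Finset.mem_filter, Finset.mem_univ, true_and] at hv
    obtain ⟨-, hvL, -, u, hu, huv⟩ := hv
    exact (hQ u v huv (h.2 hu)).resolve_right fun hvS => hvL (h.1 hvS)

lemma notMem_adoptL {P : Set (Fin n)} (hvc : I.vc ∉ S) (hS : ∀ v ∈ S, v ∉ P)
    (hP : ∀ u v, (u, v) ∈ I.edges → v ∈ P → u ∈ P ∨ u = I.vc) {v : Fin n} (hv : v ∈ P) :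
    v ∉ I.adoptL g S := by
  refine fun hvL => ((Function.Iterate.rec
    (fun a : Status n => I.vc ∈ a.1 ∧ ∀ v ∈ a.2, v ∉ P ∧ v ≠ I.vc)
    ⟨Finset.mem_singleton_self _, fun v hv => ⟨hS v hv, ne_of_mem_of_not_mem hv hvc⟩⟩
    (fun a h => ?_) n).2 v hvL).1 hv
  refine ⟨Finset.mem_union_left _ h.1, fun v hv => ?_⟩
  rcases Finset.mem_union.1 hv with hv | hv
  · exact h.2 v hv
  · simp only [newL, Finset.mem_filter, Finset.mem_univ, true_and] at hv
    obtain ⟨hvC, -, u, hu, huv⟩ := hv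
    refine ⟨fun hvP => ?_, fun hvc => hvC (hvc ▸ h.1)⟩
    exact (hP u v huv hvP).elim (h.2 u hu).1 (h.2 u hu).2

lemma mem_adoptC_empty_of_edge {u v : Fin n} (hu : u ∈ I.adoptC g ∅) (huv : (u, v) ∈ g) :
    v ∈ I.adoptC g ∅ :=
  I.mem_adoptC_of_edge hu huv
    (I.notMem_adoptL (P := Set.univ) (by simp) (by simp) (by simp) (Set.mem_univ v))

/-- Campaign `L` could enter `P` only through the adversary, which it never activates. -/
lemma mem_adoptC_of_mem_adoptC_empty {P : Set (Fin n)} (hg : g ⊆ I.edges) (hvc : I.vc ∉ S)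
    (hS : ∀ v ∈ S, v ∉ P) (hP : ∀ u v, (u, v) ∈ I.edges → v ∈ P → u ∈ P ∨ u = I.vc) {v : Fin n}
    (hv : v ∈ P) (hvC : v ∈ I.adoptC g ∅) : v ∈ I.adoptC g S := by
  refine I.adoptC_subset (Q := {v | v ∈ P → v ∈ I.adoptC g S}) (fun _ => I.vc_mem_adoptC)
    (fun x y hxy hx => Or.inl fun hy => ?_) hvC hv
  refine I.mem_adoptC_of_edge ?_ hxy (I.notMem_adoptL hvc hS hP hy)
  rcases hP x y (hg hxy) hy with hxP | rfl
  · exact hx hxP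
  · exact I.vc_mem_adoptC

lemma sdiff_adoptC_subset {P : Set (Fin n)} (hg : g ⊆ I.edges) (hvc : I.vc ∉ S)
    (hS : ∀ v ∈ S, v ∉ P) (hP : ∀ u v, (u, v) ∈ I.edges → v ∈ P → u ∈ P ∨ u = I.vc)
    (hreach : ∀ v ∈ I.adoptC g ∅, v ∈ P ∨ v ∈ S ∨ v = I.vc) :
    I.adoptC g ∅ \ I.adoptC g S ⊆ S := by
  intro v hv
  obtain ⟨hvC, hvS⟩ := Finset.mem_sdiff.1 hv
  rcases hreach v hvC with hvP | hv | rfl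
  · exact absurd (I.mem_adoptC_of_mem_adoptC_empty hg hvc hS hP hvP hvC) hvS
  · exact hv
  · exact absurd I.vc_mem_adoptC hvS

lemma card_le_prevention {T : Finset (Fin n)} (hT : T ⊆ I.adoptC g ∅) (hvc : I.vc ∉ T)
    (hTS : ∀ u v, (u, v) ∈ g → v ∈ T → u ∈ T ∨ v ∈ S) : T.card ≤ I.prevention g S := by
  have hsep := I.adoptC_subset (g := g) (S := S) (Q := {v | v ∉ T}) hvc fun u v huv hu => by
    have := hTS u v huv
    tauto
  exact Finset.card_le_card fun v hv => Finset.mem_sdiff.2 ⟨hT hv, fun hvC => hsep hvC hv⟩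

end Network

/-! ### Networks in which every edge is certain or impossible for campaign `C` -/

section Deterministic

variable {n : ℕ}

/-- The network with adversary `vc` and edge set `E` in which campaign `C` propagates along the
edges of `K` with probability one and along all others with probability zero. The adjacency lists
do not depend on `K`. -/
noncomputable def Network.deterministic (vc : Fin n) (E : Finset (Fin n × Fin n))
    (hE : ∀ v, (v, v) ∉ E) (K : Finset (Fin n × Fin n)) : Network n where
  vc := vc
  edges := E
  loopless := hE
  pC e := if e ∈ K then 1 else 0
  pC_mem e := by split_ifs <;> simp
  outList u := (Finset.univ.filter fun v => (u, v) ∈ E).toList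
  outList_nodup u := Finset.nodup_toList _
  mem_outList u v := by simp
  inList v := (Finset.univ.filter fun u => (u, v) ∈ E).toList
  inList_nodup v := Finset.nodup_toList _
  mem_inList u v := by simp

variable {vc : Fin n} {E : Finset (Fin n × Fin n)} {hE : ∀ v, (v, v) ∉ E}
  {K : Finset (Fin n × Fin n)}

lemma agreeOff_deterministic_insert (e : Fin n × Fin n) :
    (Network.deterministic vc E hE K).AgreeOff (.deterministic vc E hE (insert e K)) e where
  vc := rfl
  outList := rfl
  inList := rfl
  pC x hx := by simp [Network.deterministic, hx]

lemma realizationProb_deterministic (hK : K ⊆ E) {g : Finset (Fin n × Fin n)} :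
    (Network.deterministic vc E hE K).realizationProb g = if g = K then 1 else 0 := by
  simp only [Network.realizationProb, Network.deterministic]
  split_ifs with h
  · subst h
    rw [Finset.prod_eq_one fun e he => if_pos he, one_mul]
    exact Finset.prod_eq_one fun e he => by simp [(Finset.mem_sdiff.1 he).2]
  · by_cases hgK : g ⊆ K
    · obtain ⟨e, heK, heg⟩ := Finset.exists_of_ssubset (hgK.ssubset_of_ne h)
      exact mul_eq_zero_of_right _
        (Finset.prod_eq_zero (Finset.mem_sdiff.2 ⟨hK heK, heg⟩) (by simp [heK]))
    · obtain ⟨e, heg, heK⟩ := Finset.not_subset.1 hgK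
      exact mul_eq_zero_of_left (Finset.prod_eq_zero heg (if_neg heK)) _

lemma expectedPrevention_deterministic (hK : K ⊆ E) (S : Finset (Fin n)) :
    (Network.deterministic vc E hE K).expectedPrevention S =
      ((Network.deterministic vc E hE K).prevention K S : ℝ) := by
  have hmem : K ∈ (Network.deterministic vc E hE K).edges.powerset := Finset.mem_powerset.2 hK
  simp [Network.expectedPrevention, realizationProb_deterministic hK, hmem]

lemma exists_seedSet {k : ℕ} (hk : 1 ≤ k) (hkn : k < n) {u : Fin n} (hu : u ≠ vc) :
    ∃ S : Finset (Fin n), vc ∉ S ∧ S.card = k ∧ u ∈ S := by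
  obtain ⟨S, huS, hSvc, hcard⟩ := Finset.exists_subsuperset_card_eq (s := {u})
    (t := Finset.univ.erase vc) (n := k) (by simpa using hu) (by simpa using hk)
    (by rw [Finset.card_erase_of_mem (Finset.mem_univ vc), Finset.card_univ, Fintype.card_fin]
        omega)
  exact ⟨S, fun h => by simpa using hSvc h, hcard, by simpa using huS⟩

/-- Seeding `u` protects all of `T`, and an approximate seed set has to compete with that. -/
lemma mul_card_le_prevention_of_isApprox (hK : K ⊆ E) {k : ℕ} (hk : 1 ≤ k) (hkn : k < n) {β : ℝ}
    (hβ : 0 < β) {S T : Finset (Fin n)} {u : Fin n} (hu : u ≠ vc)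
    (hT : T ⊆ (Network.deterministic vc E hE K).adoptC K ∅) (hvc : vc ∉ T)
    (hTu : ∀ x y, (x, y) ∈ K → y ∈ T → x ∈ T ∨ y = u)
    (h : (Network.deterministic vc E hE K).IsApprox k β S) :
    β * T.card ≤ (Network.deterministic vc E hE K).prevention K S := by
  obtain ⟨S', hvcS', hcard, huS'⟩ := exists_seedSet hk hkn hu
  have hTS' : T.card ≤ (Network.deterministic vc E hE K).prevention K S' :=
    Network.card_le_prevention _ hT hvc fun x y hxy hy =>
      (hTu x y hxy hy).imp_right fun hyu : y = u => hyu ▸ huS'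
  calc β * T.card ≤ β * (Network.deterministic vc E hE K).prevention K S' := by gcongr
    _ ≤ _ := by
      simpa only [expectedPrevention_deterministic hK] using h.2.2 S' hvcS' hcard

lemma ofReal_card_mul_le_expectedTime_add {ι : Type*} [Fintype ι] {e : ι → Fin n × Fin n}
    (he : Function.Injective e) {k : ℕ} {β p : ℝ} {A : Algorithm n} (hA : A.Solves E.card k β p)
    {B : ℝ≥0∞} (hB : ∀ t, expect (A.run (.deterministic vc E hE K) t) (fun c =>
      ({i | (Network.deterministic vc E hE (insert (e i) K)).IsApprox k β c.2}.ncard : ℝ≥0∞)) ≤ B) :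
    ENNReal.ofReal (Fintype.card ι * p) ≤ A.expectedTime (.deterministic vc E hE K) + B :=
  calc ENNReal.ofReal (Fintype.card ι * p)
      = ∑ _i : ι, ENNReal.ofReal p := by
        rw [ENNReal.ofReal_mul (Nat.cast_nonneg _), ENNReal.ofReal_natCast, Finset.sum_const,
          Finset.card_univ, nsmul_eq_mul]
    _ ≤ ∑ i, A.successProb (.deterministic vc E hE (insert (e i) K)) k β :=
        Finset.sum_le_sum fun i _ => hA _ rfl
    _ ≤ _ := A.sum_successProb_le he (fun i => agreeOff_deterministic_insert (e i)) hB

end Deterministic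

/-! ### Hiding the only certain edge in a star -/

section Star

variable {n : ℕ} {vc u : Fin n}

/-- The edges of the star, which join its center `vc` to all other nodes. -/
def starEdges (vc : Fin n) : Finset (Fin n × Fin n) := {vc} ×ˢ {vc}ᶜ

lemma mem_starEdges {v : Fin n} : (u, v) ∈ starEdges vc ↔ u = vc ∧ v ≠ vc := by
  simp [starEdges, and_comm, eq_comm]

lemma card_starEdges (vc : Fin n) : (starEdges vc).card = n - 1 := by
  simp [starEdges, Finset.card_compl]

lemma starEdges_loopless (vc v : Fin n) : (v, v) ∉ starEdges vc :=
  fun h => (mem_starEdges.1 h).2 (mem_starEdges.1 h).1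

/-- The star in which campaign `C` propagates along the edges of `K` only. -/
noncomputable def starNetwork (vc : Fin n) (K : Finset (Fin n × Fin n)) : Network n :=
  .deterministic vc (starEdges vc) (starEdges_loopless vc) K

lemma numEdges_starNetwork (vc : Fin n) (K : Finset (Fin n × Fin n)) :
    (starNetwork vc K).numEdges = n - 1 :=
  card_starEdges vc

lemma prevention_starNetwork_eq_zero (hu : u ≠ vc) {S : Finset (Fin n)} (hvc : vc ∉ S)
    (huS : u ∉ S) : (starNetwork vc {(vc, u)}).prevention {(vc, u)} S = 0 := by
  have hreach : ↑((starNetwork vc {(vc, u)}).adoptC {(vc, u)} ∅) ⊆ ({vc, u} : Set (Fin n)) :=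
    Network.adoptC_subset _ (Set.mem_insert _ _) (by simp)
  have hself := (starNetwork vc {(vc, u)}).sdiff_adoptC_subset (P := {v | v ∉ S})
    (g := {(vc, u)}) (by simpa [starNetwork, Network.deterministic, mem_starEdges] using hu) hvc
    (fun v hv hv' => hv' hv) (fun x y hxy _ => Or.inr (mem_starEdges.1 hxy).1)
    (fun v _ => (em' (v ∈ S)).imp_right Or.inl)
  refine Finset.card_eq_zero.2 (Finset.eq_empty_of_forall_notMem fun v hv => ?_)
  rcases hreach (Finset.mem_sdiff.1 hv).1 with rfl | rfl
  · exact hvc (hself hv)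
  · exact huS (hself hv)

lemma mem_of_isApprox_starNetwork {k : ℕ} (hk : 1 ≤ k) (hkn : k < n) {β : ℝ} (hβ : 0 < β)
    (hu : u ≠ vc) {S : Finset (Fin n)} (h : (starNetwork vc {(vc, u)}).IsApprox k β S) :
    u ∈ S := by
  by_contra huS
  have hreach : u ∈ (starNetwork vc {(vc, u)}).adoptC {(vc, u)} ∅ :=
    Network.mem_adoptC_empty_of_edge _ (Network.vc_mem_adoptC _) (Finset.mem_singleton_self _)
  have hle : β * (Finset.card {u} : ℕ) ≤ (starNetwork vc {(vc, u)}).prevention {(vc, u)} S :=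
    mul_card_le_prevention_of_isApprox (by simpa [mem_starEdges] using hu) hk hkn hβ hu
      (Finset.singleton_subset_iff.2 hreach) (by simpa using hu.symm)
      (fun x y _ hy => Or.inr (Finset.mem_singleton.1 hy)) h
  rw [prevention_starNetwork_eq_zero hu h.1 huS] at hle
  simp only [Finset.card_singleton, Nat.cast_one, mul_one, Nat.cast_zero] at hle
  exact hβ.not_ge hle

/-- The time pays both for reading candidates and for writing their heads; hence the factor `2`. -/
lemma ofReal_le_expectedTime_starNetwork {k : ℕ} (hk : 1 ≤ k) (hkn : k < n) {β p : ℝ} (hβ : 0 < β)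
    {A : Algorithm n} (hA : A.Solves (n - 1) k β p) (vc : Fin n) :
    ENNReal.ofReal (((n : ℝ) - 1) * p / 2) ≤ A.expectedTime (starNetwork vc ∅) := by
  let J (v : {v : Fin n // v ≠ vc}) : Network n := starNetwork vc (insert (vc, v.1) ∅)
  have houtput (S : Finset (Fin n)) : {v | (J v).IsApprox k β S}.ncard ≤ S.card := by
    rw [← Set.ncard_coe_finset, ← Set.ncard_image_of_injective _ Subtype.val_injective]
    refine Set.ncard_le_ncard ?_
    rintro _ ⟨v, hv, rfl⟩
    exact mem_of_isApprox_starNetwork hk hkn hβ v.2 hv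
  have hcard : ((Fintype.card {v : Fin n // v ≠ vc} : ℕ) : ℝ) = n - 1 := by
    simp [Nat.cast_sub (Nat.one_le_of_lt hkn)]
  have htime : ENNReal.ofReal (((n : ℝ) - 1) * p) ≤
      A.expectedTime (starNetwork vc ∅) + A.expectedTime (starNetwork vc ∅) := by
    rw [← hcard]
    refine ofReal_card_mul_le_expectedTime_add (e := fun v : {v : Fin n // v ≠ vc} => (vc, v.1))
      (fun v w h => Subtype.ext (Prod.ext_iff.1 h).2) (by rwa [card_starEdges]) fun t => ?_
    refine (expect_mono _ fun c => ?_).trans (A.expect_card_output_le_expectedTime _ t)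
    exact Nat.cast_le.2 (houtput c.2)
  rw [ENNReal.ofReal_div_of_pos two_pos, ENNReal.ofReal_ofNat]
  exact ENNReal.div_le_of_le_mul (htime.trans_eq (mul_two _).symm)

end Star

/-! ### Hiding one certain edge in disjoint complete bipartite graphs -/

section Blocks

/-- The nodes of the block network: the adversary `root`, in each of `q` blocks `a` sources and `b`
hubs with `R` leaves each, and `f` filler nodes. -/
inductive Site (q a b R f : ℕ) where
  | root
  | source (j : Fin q) (x : Fin a)
  | hub (j : Fin q) (y : Fin b)
  | leaf (j : Fin q) (y : Fin b) (r : Fin R)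
  | filler (i : Fin f)

namespace Site

variable {q a b R f : ℕ}

/-- Sites as a sum type, for counting them. -/
def equivSum : Site q a b R f ≃
    Unit ⊕ (Fin q × Fin a) ⊕ (Fin q × Fin b) ⊕ (Fin q × Fin b × Fin R) ⊕ Fin f where
  toFun
    | root => .inl ()
    | source j x => .inr (.inl (j, x))
    | hub j y => .inr (.inr (.inl (j, y)))
    | leaf j y r => .inr (.inr (.inr (.inl (j, y, r))))
    | filler i => .inr (.inr (.inr (.inr i)))
  invFun
    | .inl _ => root
    | .inr (.inl (j, x)) => source j x
    | .inr (.inr (.inl (j, y))) => hub j y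
    | .inr (.inr (.inr (.inl (j, y, r)))) => leaf j y r
    | .inr (.inr (.inr (.inr i))) => filler i
  left_inv s := by cases s <;> rfl
  right_inv s := by rcases s with _ | _ | _ | _ | _ <;> rfl

instance : Fintype (Site q a b R f) := Fintype.ofEquiv _ equivSum.symm

lemma card : Fintype.card (Site q a b R f) = 1 + q * a + q * b + q * b * R + f := by
  rw [Fintype.card_congr equivSum]
  simp only [Fintype.card_sum, Fintype.card_prod, Fintype.card_fin, Fintype.card_unit]
  ring

/-- The block of a site, if it belongs to one. -/
def block : Site q a b R f → Option (Fin q)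
  | source j _ => some j
  | hub j _ => some j
  | leaf j _ _ => some j
  | _ => none

end Site

variable {q a b R f n : ℕ} (φ : Site q a b R f ≃ Fin n)

/-- The edges from the root to the sources. -/
def rootEdges : Finset (Fin n × Fin n) :=
  Finset.univ.image fun i : Fin q × Fin a => (φ .root, φ (.source i.1 i.2))

/-- The edge from source `i.2.1` to hub `i.2.2` of block `i.1`, one of the candidates for the hidden
edge. -/
def hubEdge (i : Fin q × Fin a × Fin b) : Fin n × Fin n :=
  (φ (.source i.1 i.2.1), φ (.hub i.1 i.2.2))

/-- The edges from the sources to the hubs of their block. -/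
def hubEdges : Finset (Fin n × Fin n) := Finset.univ.image (hubEdge φ)

/-- The edges from the hubs to their leaves. -/
def leafEdges : Finset (Fin n × Fin n) :=
  Finset.univ.image fun i : Fin q × Fin b × Fin R =>
    (φ (.hub i.1 i.2.1), φ (.leaf i.1 i.2.1 i.2.2))

/-- The edges between filler nodes, which are available for adjusting the number of edges. -/
def fillerEdges : Finset (Fin n × Fin n) :=
  (Finset.univ.image fun i : Fin f => φ (.filler i)).offDiag

/-- The edges between the nodes other than filler nodes. -/
def coreEdges : Finset (Fin n × Fin n) := rootEdges φ ∪ hubEdges φ ∪ leafEdges φ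

/-- The edges of the block network, of which the edges `F` between filler nodes can be chosen. -/
def blockEdges (F : Finset (Fin n × Fin n)) : Finset (Fin n × Fin n) := coreEdges φ ∪ F

/-- The edges that are certain independently of the hidden edge. -/
def certainEdges : Finset (Fin n × Fin n) := rootEdges φ ∪ leafEdges φ

/-- The certain edges if the hidden edge is the one given by `i`. -/
def revealedEdges (i : Fin q × Fin a × Fin b) : Finset (Fin n × Fin n) :=
  insert (hubEdge φ i) (certainEdges φ)

/-- The head of the hidden edge and its leaves. -/
def hiddenStar (i : Fin q × Fin a × Fin b) : Finset (Fin n) :=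
  insert (φ (.hub i.1 i.2.2)) (Finset.univ.image fun r => φ (.leaf i.1 i.2.2 r))

lemma hubEdge_injective : Function.Injective (hubEdge φ) := by
  rintro ⟨j, x, y⟩ ⟨j', x', y'⟩ h
  simp only [hubEdge, Prod.mk.injEq, EmbeddingLike.apply_eq_iff_eq, Site.source.injEq,
    Site.hub.injEq] at h
  obtain ⟨⟨rfl, rfl⟩, -, rfl⟩ := h
  rfl

lemma card_coreEdges_le : (coreEdges φ).card ≤ q * a + q * a * b + q * b * R := by
  refine (Finset.card_union_le _ _).trans (add_le_add
    ((Finset.card_union_le _ _).trans (add_le_add ?_ ?_)) ?_) <;>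
  exact Finset.card_image_le.trans (by simp [mul_assoc])

lemma card_fillerEdges : (fillerEdges φ).card = f * f - f := by
  rw [fillerEdges, Finset.offDiag_card, Finset.card_image_of_injective, Finset.card_univ,
    Fintype.card_fin]
  exact fun i j h => by simpa using h

lemma card_hiddenStar (i : Fin q × Fin a × Fin b) : (hiddenStar φ i).card = R + 1 := by
  rw [hiddenStar, Finset.card_insert_of_notMem (by simp), Finset.card_image_of_injective,
    Finset.card_univ, Fintype.card_fin]
  exact fun r r' h => by simpa using h

variable {φ} {u v : Fin n} {F : Finset (Fin n × Fin n)}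

lemma mem_rootEdges :
    (u, v) ∈ rootEdges φ ↔ ∃ j x, u = φ .root ∧ v = φ (.source j x) := by
  simp [rootEdges, eq_comm]

lemma mem_hubEdges :
    (u, v) ∈ hubEdges φ ↔ ∃ j x y, u = φ (.source j x) ∧ v = φ (.hub j y) := by
  simp [hubEdges, hubEdge, eq_comm]

lemma mem_leafEdges :
    (u, v) ∈ leafEdges φ ↔ ∃ j y r, u = φ (.hub j y) ∧ v = φ (.leaf j y r) := by
  simp [leafEdges, eq_comm]

lemma mem_fillerEdges :
    (u, v) ∈ fillerEdges φ ↔ ∃ i j, i ≠ j ∧ u = φ (.filler i) ∧ v = φ (.filler j) := by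
  simp only [fillerEdges, Finset.mem_offDiag, Finset.mem_image, Finset.mem_univ, true_and]
  constructor
  · rintro ⟨⟨i, rfl⟩, ⟨j, rfl⟩, h⟩
    exact ⟨i, j, by simpa using h, rfl, rfl⟩
  · rintro ⟨i, j, h, rfl, rfl⟩
    exact ⟨⟨i, rfl⟩, ⟨j, rfl⟩, by simpa using h⟩

lemma mem_coreEdges : (u, v) ∈ coreEdges φ ↔
    (∃ j x, u = φ .root ∧ v = φ (.source j x)) ∨
      (∃ j x y, u = φ (.source j x) ∧ v = φ (.hub j y)) ∨
        ∃ j y r, u = φ (.hub j y) ∧ v = φ (.leaf j y r) := by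
  simp only [coreEdges, Finset.mem_union, or_assoc, mem_rootEdges, mem_hubEdges, mem_leafEdges]

lemma mem_revealedEdges {i : Fin q × Fin a × Fin b} : (u, v) ∈ revealedEdges φ i ↔
    (u = φ (.source i.1 i.2.1) ∧ v = φ (.hub i.1 i.2.2)) ∨
      (∃ j x, u = φ .root ∧ v = φ (.source j x)) ∨
        ∃ j y r, u = φ (.hub j y) ∧ v = φ (.leaf j y r) := by
  simp only [revealedEdges, certainEdges, Finset.mem_insert, Finset.mem_union, mem_rootEdges,
    mem_leafEdges, hubEdge, Prod.mk.injEq]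

lemma revealedEdges_subset (i : Fin q × Fin a × Fin b) : revealedEdges φ i ⊆ blockEdges φ F := by
  rintro ⟨u, v⟩ h
  refine Finset.mem_union_left _ (mem_coreEdges.2 ?_)
  rcases mem_revealedEdges.1 h with h | h | h
  · exact Or.inr (Or.inl ⟨i.1, i.2.1, i.2.2, h⟩)
  · exact Or.inl h
  · exact Or.inr (Or.inr h)

lemma blockEdges_loopless (hF : F ⊆ fillerEdges φ) (v : Fin n) : (v, v) ∉ blockEdges φ F := by
  intro h
  rcases Finset.mem_union.1 h with h | h
  · rcases mem_coreEdges.1 h with ⟨j, x, rfl, h⟩ | ⟨j, x, y, rfl, h⟩ | ⟨j, y, r, rfl, h⟩ <;>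
    simp at h
  · obtain ⟨i, j, hij, rfl, h⟩ := mem_fillerEdges.1 (hF h)
    exact hij (by simpa using h)

lemma disjoint_coreEdges_fillerEdges : Disjoint (coreEdges φ) (fillerEdges φ) := by
  rw [Finset.disjoint_left]
  rintro ⟨u, v⟩ hcore hfiller
  obtain ⟨i, j, -, rfl, rfl⟩ := mem_fillerEdges.1 hfiller
  simp [mem_coreEdges] at hcore

variable (φ) in
lemma exists_card_blockEdges {m : ℕ} (hcore : q * a + q * a * b + q * b * R ≤ m)
    (hfiller : m ≤ f * f - f) : ∃ F ⊆ fillerEdges φ, (blockEdges φ F).card = m := by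
  have hle : (coreEdges φ).card ≤ m := (card_coreEdges_le φ).trans hcore
  obtain ⟨F, hF, hcard⟩ := Finset.exists_subset_card_eq (s := fillerEdges φ)
    (n := m - (coreEdges φ).card) (by rw [card_fillerEdges]; omega)
  refine ⟨F, hF, ?_⟩
  rw [blockEdges, Finset.card_union_of_disjoint (disjoint_coreEdges_fillerEdges.mono_right hF),
    hcard]
  omega

/-- The block network in which campaign `C` propagates along the edges of `K` only. -/
noncomputable def blockNetwork (hF : F ⊆ fillerEdges φ) (K : Finset (Fin n × Fin n)) : Network n :=
  .deterministic (φ .root) (blockEdges φ F) (blockEdges_loopless hF) K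

lemma hiddenStar_subset_adoptC_empty (hF : F ⊆ fillerEdges φ) (i : Fin q × Fin a × Fin b) :
    hiddenStar φ i ⊆ (blockNetwork hF (revealedEdges φ i)).adoptC (revealedEdges φ i) ∅ := by
  set reached := (blockNetwork hF (revealedEdges φ i)).adoptC (revealedEdges φ i) ∅
  have hsource : φ (.source i.1 i.2.1) ∈ reached :=
    Network.mem_adoptC_empty_of_edge _ (Network.vc_mem_adoptC _)
      (mem_revealedEdges.2 (Or.inr (Or.inl ⟨_, _, rfl, rfl⟩)))
  have hhub : φ (.hub i.1 i.2.2) ∈ reached :=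
    Network.mem_adoptC_empty_of_edge _ hsource (mem_revealedEdges.2 (Or.inl ⟨rfl, rfl⟩))
  simp only [hiddenStar, Finset.insert_subset_iff, Finset.image_subset_iff]
  exact ⟨hhub, fun r _ => Network.mem_adoptC_empty_of_edge _ hhub
    (mem_revealedEdges.2 (Or.inr (Or.inr ⟨_, _, r, rfl, rfl⟩)))⟩

lemma le_prevention_of_isApprox_blockNetwork {k : ℕ} (hk : 1 ≤ k) (hkn : k < n) {β : ℝ}
    (hβ : 0 < β) (hF : F ⊆ fillerEdges φ) {i : Fin q × Fin a × Fin b} {S : Finset (Fin n)}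
    (h : (blockNetwork hF (revealedEdges φ i)).IsApprox k β S) :
    β * (R + 1) ≤ (blockNetwork hF (revealedEdges φ i)).prevention (revealedEdges φ i) S := by
  have hle : β * (hiddenStar φ i).card ≤
      (blockNetwork hF (revealedEdges φ i)).prevention (revealedEdges φ i) S := by
    refine mul_card_le_prevention_of_isApprox (u := φ (.hub i.1 i.2.2)) (revealedEdges_subset i)
      hk hkn hβ (by simp) (hiddenStar_subset_adoptC_empty hF i) (by simp [hiddenStar])
      (fun x y hxy hy => ?_) h
    rcases mem_revealedEdges.1 hxy with ⟨-, rfl⟩ | ⟨j, x, rfl, rfl⟩ | ⟨j, y, r, rfl, rfl⟩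
    · exact Or.inr rfl
    · simp [hiddenStar] at hy
    · obtain ⟨rfl, rfl⟩ : i.1 = j ∧ i.2.2 = y := by simpa [hiddenStar] using hy
      exact Or.inl (Finset.mem_insert_self _ _)
  simpa [card_hiddenStar] using hle

lemma prevention_blockNetwork_le_card (hF : F ⊆ fillerEdges φ) {i : Fin q × Fin a × Fin b}
    {S : Finset (Fin n)} (hroot : φ .root ∉ S) (hS : ∀ v ∈ S, (φ.symm v).block ≠ some i.1) :
    (blockNetwork hF (revealedEdges φ i)).prevention (revealedEdges φ i) S ≤ S.card := by
  have hreach : ↑((blockNetwork hF (revealedEdges φ i)).adoptC (revealedEdges φ i) ∅) ⊆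
      {v | v = φ .root ∨ (∃ j x, v = φ (.source j x)) ∨ (φ.symm v).block = some i.1} := by
    refine Network.adoptC_subset _ (Or.inl rfl) fun u v huv hu => Or.inl ?_
    rcases mem_revealedEdges.1 huv with ⟨rfl, rfl⟩ | ⟨j, x, rfl, rfl⟩ | ⟨j, y, r, rfl, rfl⟩
    · simp [Site.block]
    · simp
    · simpa [Site.block] using hu
  refine Finset.card_le_card (Network.sdiff_adoptC_subset _
    (P := {v | (φ.symm v).block = some i.1 ∨ (∃ j x, v = φ (.source j x)) ∧ v ∉ S})
    (revealedEdges_subset i) hroot ?_ ?_ ?_)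
  · rintro v hv (hblock | hsource)
    · exact hS v hv hblock
    · exact hsource.2 hv
  · intro u v huv hv
    rcases Finset.mem_union.1 huv with huv | huv
    · rcases mem_coreEdges.1 huv with ⟨j, x, rfl, rfl⟩ | ⟨j, x, y, rfl, rfl⟩ | ⟨j, y, r, rfl, rfl⟩
      · exact Or.inr rfl
      · exact Or.inl (Or.inl (by simpa [Site.block] using hv))
      · exact Or.inl (Or.inl (by simpa [Site.block] using hv))
    · obtain ⟨i', j, -, rfl, rfl⟩ := mem_fillerEdges.1 (hF huv)
      simp [Site.block] at hv
  · intro v hv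
    rcases hreach hv with rfl | hsource | hblock
    · exact Or.inr (Or.inr rfl)
    · exact (em' (v ∈ S)).imp (fun hvS => Or.inr ⟨hsource, hvS⟩) Or.inl
    · exact Or.inl (Or.inl hblock)

lemma exists_mem_of_isApprox_blockNetwork {k : ℕ} (hk : 1 ≤ k) (hkn : k < n) {β : ℝ}
    (hβ : 0 < β) (hR : (k : ℝ) / β ≤ R) (hF : F ⊆ fillerEdges φ) {i : Fin q × Fin a × Fin b}
    {S : Finset (Fin n)} (h : (blockNetwork hF (revealedEdges φ i)).IsApprox k β S) :
    ∃ v ∈ S, (φ.symm v).block = some i.1 := by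
  by_contra! hS
  have hupper : ((blockNetwork hF (revealedEdges φ i)).prevention (revealedEdges φ i) S : ℝ) ≤ k :=
    Nat.cast_le.2 ((prevention_blockNetwork_le_card hF h.1 hS).trans h.2.1)
  have hlower := (le_prevention_of_isApprox_blockNetwork hk hkn hβ hF h).trans hupper
  rw [div_le_iff₀ hβ] at hR
  linarith

lemma ncard_isApprox_blockNetwork_le {k : ℕ} (hk : 1 ≤ k) (hkn : k < n) {β : ℝ} (hβ : 0 < β)
    (hR : (k : ℝ) / β ≤ R) (hF : F ⊆ fillerEdges φ) (S : Finset (Fin n)) :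
    {i | (blockNetwork hF (revealedEdges φ i)).IsApprox k β S}.ncard ≤ k * (a * b) := by
  rcases Set.eq_empty_or_nonempty {i | (blockNetwork hF (revealedEdges φ i)).IsApprox k β S} with
    hempty | ⟨i₀, hi₀⟩
  · simp [hempty]
  let blocks : Finset (Fin q) := S.biUnion fun v => (φ.symm v).block.toFinset
  have hblocks : blocks.card ≤ k := by
    refine (Finset.card_biUnion_le_card_mul S _ 1 fun v _ => ?_).trans (by simpa using hi₀.2.1)
    cases (φ.symm v).block <;> simp
  have hsubset : {i | (blockNetwork hF (revealedEdges φ i)).IsApprox k β S} ⊆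
      ↑(blocks ×ˢ (Finset.univ : Finset (Fin a × Fin b))) := fun i hi => by
    simpa [blocks] using exists_mem_of_isApprox_blockNetwork hk hkn hβ hR hF hi
  calc _ ≤ (blocks ×ˢ (Finset.univ : Finset (Fin a × Fin b))).card :=
        (Set.ncard_le_ncard hsubset).trans_eq (Set.ncard_coe_finset _)
    _ = blocks.card * (a * b) := by simp [Finset.card_product]
    _ ≤ k * (a * b) := Nat.mul_le_mul_right _ hblocks

lemma ofReal_le_expectedTime_blockNetwork {k m : ℕ} (hk : 1 ≤ k) (hkn : k < n) {β p : ℝ}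
    (hβ : 0 < β) (hR : (k : ℝ) / β ≤ R) {A : Algorithm n} (hA : A.Solves m k β p)
    (hF : F ⊆ fillerEdges φ) (hm : (blockEdges φ F).card = m) :
    ENNReal.ofReal ((q * p - k) * (a * b)) ≤
      A.expectedTime (blockNetwork hF (certainEdges φ)) := by
  have htime : ENNReal.ofReal (Fintype.card (Fin q × Fin a × Fin b) * p) ≤
      A.expectedTime (blockNetwork hF (certainEdges φ)) + (k * (a * b) : ℕ) :=
    ofReal_card_mul_le_expectedTime_add (hubEdge_injective φ) (by rwa [hm]) fun t =>
      expect_le_of_le _ fun c => Nat.cast_le.2 (ncard_isApprox_blockNetwork_le hk hkn hβ hR hF c.2)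
  rw [← tsub_le_iff_right, ← ENNReal.ofReal_natCast, ← ENNReal.ofReal_sub _ (Nat.cast_nonneg _)]
    at htime
  convert htime using 2
  simp only [Fintype.card_prod, Fintype.card_fin]
  push_cast
  ring

end Blocks

/-! ### The sizes of the block network -/

lemma exists_hub_count {W n m : ℕ} (hn : 72 * W + 24 ≤ n) (hm : 24 * W * m ≤ n ^ 2) :
    ∃ b, 3 ≤ b ∧ m ≤ b * n ∧ 12 * (W * b) + 12 ≤ n := by
  have hpos : 0 < n := by omega
  have hlt : m < n * (m / n + 1) := Nat.lt_mul_div_succ m hpos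
  have hdiv : 24 * (W * (m / n)) ≤ n := by
    refine Nat.le_of_mul_le_mul_right (?_ : _ * n ≤ n * n) hpos
    calc 24 * (W * (m / n)) * n = 24 * W * (m / n * n) := by ring
      _ ≤ 24 * W * m := Nat.mul_le_mul_left _ (Nat.div_mul_le_self m n)
      _ ≤ n * n := by rwa [← sq]
  refine ⟨m / n + 3, Nat.le_add_left 3 _, by nlinarith, ?_⟩
  rw [mul_add]
  omega

lemma exists_source_count {q b n m : ℕ} (hq : 1 ≤ q) (hb : 1 ≤ b) (hmb : m ≤ b * n)
    (hqb : 12 * (q * b) ≤ m) :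
    ∃ a, 3 * (q * a * b) ≤ m ∧ m ≤ 4 * (q * a * b) ∧ 3 * (q * a) ≤ n := by
  have hpos : 0 < 3 * (q * b) := by positivity
  have hlt : m < 3 * (q * b) * (m / (3 * (q * b)) + 1) := Nat.lt_mul_div_succ m hpos
  have hle : m / (3 * (q * b)) * (3 * (q * b)) ≤ m := Nat.div_mul_le_self m _
  refine ⟨m / (3 * (q * b)), by linarith, by nlinarith, ?_⟩
  refine Nat.le_of_mul_le_mul_left (?_ : b * _ ≤ b * n) hb
  linarith

lemma exists_block_sizes {q R n m : ℕ} (hq : 1 ≤ q) (hn : 72 * (q * (1 + R)) + 24 ≤ n)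
    (hnm : n - 1 ≤ m) (hm : 24 * (q * (1 + R)) * m ≤ n ^ 2) :
    ∃ a b f : ℕ, 1 + q * a + q * b + q * b * R + f = n ∧
      q * a + q * a * b + q * b * R ≤ m ∧ m ≤ f * f - f ∧ m ≤ 4 * (q * a * b) := by
  obtain ⟨b, hb, hmb, hWb⟩ := exists_hub_count hn hm
  have hsplit : q * (1 + R) * b = q * b + q * b * R := by ring
  obtain ⟨a, habm, hmab, han⟩ := exists_source_count hq (by omega : 1 ≤ b) hmb (by omega)
  have : 3 * (q * a) ≤ q * a * b := by nlinarith
  obtain ⟨f, hf⟩ := Nat.exists_eq_add_of_le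
    (by omega : 1 + q * a + q * b + q * b * R ≤ n)
  refine ⟨a, b, f, hf.symm, by omega, Nat.le_sub_of_add_le ?_, hmab⟩
  have hmf : 24 * m ≤ (2 * f) ^ 2 :=
    calc 24 * m ≤ 24 * (q * (1 + R)) * m := by nlinarith [Nat.mul_pos hq R.succ_pos]
      _ ≤ n ^ 2 := hm
      _ ≤ (2 * f) ^ 2 := Nat.pow_le_pow_left (by omega) 2
  have hff : 2 * f ≤ f * f := Nat.mul_le_mul_right f (by omega)
  linarith

/-! ### Lower bounds for sparse and for dense networks -/

section LowerBounds

variable {n k : ℕ} {β p : ℝ} {A : Algorithm n}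

lemma exists_sparse_le_expectedTime (hk : 1 ≤ k) (hkn : k < n) (hβ : 0 < β) (hp : 0 < p)
    (hA : A.Solves (n - 1) k β p) :
    ∃ I : Network n, I.numEdges = n - 1 ∧
      ENNReal.ofReal (p * ((I.numEdges : ℝ) + n) / 12) ≤ A.expectedTime I := by
  let vc : Fin n := ⟨0, by omega⟩
  refine ⟨starNetwork vc ∅, numEdges_starNetwork vc ∅,
    le_trans (ENNReal.ofReal_le_ofReal ?_) (ofReal_le_expectedTime_starNetwork hk hkn hβ hA vc)⟩
  have hn : (2 : ℝ) ≤ n := by exact_mod_cast hk.trans_lt hkn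
  rw [numEdges_starNetwork, Nat.cast_pred (by omega)]
  nlinarith

lemma exists_dense_le_expectedTime {q R m : ℕ} (hk : 1 ≤ k) (hβ : 0 < β) (hp : 0 < p)
    (hq : (4 * k : ℝ) / p ≤ q) (hR : (k : ℝ) / β ≤ R) (hkn : k < n)
    (hn : 72 * (q * (1 + R)) + 24 ≤ n) (hnm : n - 1 ≤ m) (hm : 24 * (q * (1 + R)) * m ≤ n ^ 2)
    (hA : A.Solves m k β p) :
    ∃ I : Network n, I.numEdges = m ∧
      ENNReal.ofReal (p * ((I.numEdges : ℝ) + n) / 12) ≤ A.expectedTime I := by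
  have hqp : 4 * k ≤ q * p := (div_le_iff₀ hp).1 hq
  have : 0 < k := hk
  have hq1 : 1 ≤ q := Nat.cast_pos.1 ((by positivity : 0 < 4 * (k : ℝ) / p).trans_le hq)
  obtain ⟨a, b, f, hsites, hcore, hfiller, hab⟩ := exists_block_sizes hq1 hn hnm hm
  let φ : Site q a b R f ≃ Fin n := Fintype.equivFinOfCardEq (Site.card.trans hsites)
  obtain ⟨F, hF, hcard⟩ := exists_card_blockEdges φ hcore hfiller
  refine ⟨blockNetwork hF (certainEdges φ), hcard, le_trans (ENNReal.ofReal_le_ofReal ?_)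
    (ofReal_le_expectedTime_blockNetwork hk hkn hβ hR hA hF hcard)⟩
  rw [show (blockNetwork hF (certainEdges φ)).numEdges = m from hcard]
  have hm4 : (4 : ℝ) ≤ m := by exact_mod_cast (by omega : 4 ≤ m)
  have hnm' : (n : ℝ) ≤ m + 1 := by exact_mod_cast (by omega : n ≤ m + 1)
  have hab' : (m : ℝ) ≤ 4 * (q * (a * b)) := by
    rw [← mul_assoc (q : ℝ)]
    exact_mod_cast hab
  calc p * ((m : ℝ) + n) / 12 ≤ p * (9 / 4 * m) / 12 := by gcongr; linarith
    _ = 3 / 4 * p * (m / 4) := by ring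
    _ ≤ 3 / 4 * p * (q * (a * b)) := by gcongr; linarith
    _ = (q * p - q * p / 4) * (a * b) := by ring
    _ ≤ (q * p - k) * (a * b) := by gcongr; linarith

lemma Algorithm.Solves.mono {m : ℕ} {p' : ℝ} (hA : A.Solves m k β p) (hp : p' ≤ p) :
    A.Solves m k β p' :=
  fun I hI => (ENNReal.ofReal_le_ofReal hp).trans (hA I hI)

lemma half_le_one_sub_inv_exp_sub {ε : ℝ} (hε : ε < 1 / (10 * Real.exp 1)) :
    1 / 2 ≤ 1 - 1 / Real.exp 1 - ε := by
  have hexp : 1 / Real.exp 1 ≤ 2 / 5 := by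
    rw [div_le_div_iff₀ (Real.exp_pos 1) (by norm_num)]
    linarith [Real.exp_one_gt_d9]
  have hsplit : 1 / (10 * Real.exp 1) = 1 / Real.exp 1 / 10 := by field_simp
  linarith

lemma mul_div_min_le {N : ℝ} (hk : 1 ≤ k) (hβ0 : 0 < β) (hβ1 : β ≤ 1) (hN : 0 ≤ N) :
    β * N / (24 * min (k : ℝ) (1 / β)) ≤ 1 / 2 * N / 12 := by
  have hmin : 1 ≤ min (k : ℝ) (1 / β) :=
    le_min (Nat.one_le_cast.2 hk) ((one_le_div hβ0).2 hβ1)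
  calc β * N / (24 * min (k : ℝ) (1 / β)) ≤ 1 * N / (24 * 1) := by gcongr
    _ = 1 / 2 * N / 12 := by ring

end LowerBounds

end EIL

theorem theorem3_general (k : ℕ) (hk : 1 ≤ k) (β : ℝ) (hβ : 0 < β) (p : ℝ) (hp : 0 < p) :
    (∀ n : ℕ, k < n → ∀ A : EIL.Algorithm n, A.Solves (n - 1) k β p →
      ∃ I : EIL.Network n, I.numEdges = n - 1 ∧
        ENNReal.ofReal (p * ((I.numEdges : ℝ) + n) / 12) ≤ A.expectedTime I) ∧
    (∃ (c : ℝ) (n₀ : ℕ), 0 < c ∧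
      ∀ n m : ℕ, n₀ ≤ n → n - 1 ≤ m → (m : ℝ) ≤ c * (n : ℝ) ^ 2 → ∀ A : EIL.Algorithm n,
        A.Solves m k β p →
          ∃ I : EIL.Network n, I.numEdges = m ∧
            ENNReal.ofReal (p * ((I.numEdges : ℝ) + n) / 12) ≤ A.expectedTime I) := by
  refine ⟨fun n hkn A hA => EIL.exists_sparse_le_expectedTime hk hkn hβ hp hA, ?_⟩
  obtain ⟨q, hq⟩ := exists_nat_gt (4 * (k : ℝ) / p)
  obtain ⟨R, hR⟩ := exists_nat_ge ((k : ℝ) / β)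
  have hq0 : (0 : ℝ) < q := (by positivity : 0 ≤ 4 * (k : ℝ) / p).trans_lt hq
  have hW : (0 : ℝ) < 24 * (q * (1 + R)) := by positivity
  refine ⟨1 / (24 * (q * (1 + R))), 72 * (q * (1 + R)) + 24 + k, one_div_pos.2 hW,
    fun n m hn hnm hm A hA => ?_⟩
  rw [one_div_mul_eq_div, le_div_iff₀' hW] at hm
  exact EIL.exists_dense_le_expectedTime hk hβ hp hq.le hR (by omega) (by omega) hnm
    (by exact_mod_cast hm) hA

/-- Lower bound for eventual influence limitation, for all `n > k` on networks with `n - 1` edges,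
and for fixed `k` and `β` and all large `n` on networks with any number of edges between `n - 1` and
a constant multiple of `n ^ 2`. -/
theorem theorem3 (k : ℕ) (hk : 1 ≤ k) (β : ℝ) (hβ0 : 0 < β) (hβ1 : β ≤ 1) :
    (∀ ε : ℝ, 0 < ε → ε < 1 / (10 * Real.exp 1) →
      ∀ n : ℕ, k < n → ∀ A : EIL.Algorithm n,
        A.Solves (n - 1) k β (1 - 1 / Real.exp 1 - ε) →
          ∃ I : EIL.Network n, I.numEdges = n - 1 ∧
            ENNReal.ofReal (β * ((I.numEdges : ℝ) + n) / (24 * min (k : ℝ) (1 / β)))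
              ≤ A.expectedTime I) ∧
    (∃ (c : ℝ) (n₀ : ℕ), 0 < c ∧
      ∀ ε : ℝ, 0 < ε → ε < 1 / (10 * Real.exp 1) →
        ∀ n m : ℕ, n₀ ≤ n → n - 1 ≤ m → (m : ℝ) ≤ c * (n : ℝ) ^ 2 → ∀ A : EIL.Algorithm n,
          A.Solves m k β (1 - 1 / Real.exp 1 - ε) →
            ∃ I : EIL.Network n, I.numEdges = m ∧
              ENNReal.ofReal (β * ((I.numEdges : ℝ) + n) / (24 * min (k : ℝ) (1 / β)))
                ≤ A.expectedTime I) := by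
  obtain ⟨hsparse, c, n₀, hc, hdense⟩ := theorem3_general k hk β hβ0 (1 / 2) one_half_pos
  have hbound {n : ℕ} (I : EIL.Network n) := ENNReal.ofReal_le_ofReal
    (EIL.mul_div_min_le hk hβ0 hβ1 (by positivity : 0 ≤ (I.numEdges : ℝ) + n))
  refine ⟨fun ε _ hε n hkn A hA => ?_, c, n₀, hc, fun ε _ hε n m hn hnm hm A hA => ?_⟩
  · exact (hsparse n hkn A (hA.mono (EIL.half_le_one_sub_inv_exp_sub hε))).imp
      fun I hI => hI.imp_right (hbound I).trans
  · exact (hdense n m hn hnm hm A (hA.mono (EIL.half_le_one_sub_inv_exp_sub hε))).imp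
      fun I hI => hI.imp_right (hbound I).trans
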